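/- Call $\operatorname{size}(a)=\lceil\log_2(|a|+1)\rceil+1$ the bit size of an integer $a$, and let the bit size of an integer matrix or vector be the sum of the bit sizes of its entries. There is an algorithm that, given any positive integer $m$, any integer $n\ge 0$, any matrix $A\in\mathbb Z^{m\times n}$ and any vector $b\in\mathbb Z^m$, halts and - if the system $Ax=b$ has a solution $x\in\mathbb R^n$, outputs integers $x_0\neq 0$ and $x_1,\dots,x_n$ such that $x=\frac{1}{x_0}[x_1,\dots,x_n]^\top$ satisfies $Ax=b$; - if the system $Ax=b$ has no solution in $\mathbb R^n$, outputs that it has no solution. Moreover, the bit complexity of the algorithm is polynomial: there is a polynomial $p$, not depending on $m,n,A,b$, such that on every input $(A,b)$ the running time is at most $p(\operatorname{size}(A)+\operatorname{size}(b))$. Here an algorithm is a single random access program (integer registers and arrays, $+,-,\times$ and integer division, branching and loops), and its running time is the bit cost of its run: each step costs $1$ plus the bit sizes of all numbers and array indices that it reads and writes, each addition or subtraction costs in addition the sum, and each multiplication or division the product, of the bit sizes of its operands. -/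

import Mathlib

open scoped Matrix

/-- The bit size `⌈log₂ (|a| + 1)⌉ + 1` of an integer; `Nat.clog` is the logarithm rounded up. -/
def bitSize (a : ℤ) : ℕ := Nat.clog 2 (a.natAbs + 1) + 1

/-- The bit size of an integer vector: the sum of the bit sizes of its entries. -/
def vecBitSize {m : ℕ} (b : Fin m → ℤ) : ℕ := ∑ i, bitSize (b i)

/-- The bit size of an integer matrix: the sum of the bit sizes of its entries. -/
def matBitSize {m n : ℕ} (A : Matrix (Fin m) (Fin n) ℤ) : ℕ := ∑ i, ∑ j, bitSize (A i j)

/-! Bit complexity is measured on random access programs with logarithmic cost. A program uses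
finitely many integer registers and finitely many integer arrays. Every access to a number
costs the bit size of that number, an access to an array cell also costs the bit size of the index,
an addition or subtraction costs the sum of the bit sizes of its operands, and a multiplication or
division costs their product (the cost of the schoolbook methods). -/

namespace BitRAM

/-- The contents of the registers and of the arrays. -/
structure State where
  reg : ℕ → ℤ
  arr : ℕ → ℤ → ℤ

/-- Write `v` into register `x`. -/
def State.setReg (s : State) (x : ℕ) (v : ℤ) : State :=
  { s with reg := Function.update s.reg x v }

/-- Write `v` into cell `i` of array `a`. -/
def State.setArr (s : State) (a : ℕ) (i v : ℤ) : State :=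
  { s with arr := Function.update s.arr a (Function.update (s.arr a) i v) }

/-- Arithmetic expressions. Register names and array names are fixed in the program text,
array indices are computed. -/
inductive Expr : Type
  | const (c : ℤ)
  | reg (x : ℕ)
  | arr (a : ℕ) (i : Expr)
  | add (e f : Expr)
  | sub (e f : Expr)
  | mul (e f : Expr)
  | div (e f : Expr)

/-- The value of an expression; `div` is the integer quotient (`0` if the divisor is `0`). -/
def Expr.eval (s : State) : Expr → ℤ
  | .const c => c
  | .reg x => s.reg x
  | .arr a i => s.arr a (i.eval s)
  | .add e f => e.eval s + f.eval s
  | .sub e f => e.eval s - f.eval s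
  | .mul e f => e.eval s * f.eval s
  | .div e f => e.eval s / f.eval s

/-- The bit cost of evaluating an expression. -/
def Expr.cost (s : State) : Expr → ℕ
  | .const c => bitSize c
  | .reg x => bitSize (s.reg x)
  | .arr a i => i.cost s + bitSize (i.eval s) + bitSize (s.arr a (i.eval s))
  | .add e f => e.cost s + f.cost s + (bitSize (e.eval s) + bitSize (f.eval s))
  | .sub e f => e.cost s + f.cost s + (bitSize (e.eval s) + bitSize (f.eval s))
  | .mul e f => e.cost s + f.cost s + bitSize (e.eval s) * bitSize (f.eval s)
  | .div e f => e.cost s + f.cost s + bitSize (e.eval s) * bitSize (f.eval s)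

/-- Programs: assignment to a register, assignment to an array cell, composition, branching on
`0 < e`, and iteration as long as `0 < e`. -/
inductive Prog : Type
  | skip
  | assign (x : ℕ) (e : Expr)
  | store (a : ℕ) (i e : Expr)
  | seq (c d : Prog)
  | ite (e : Expr) (c d : Prog)
  | loop (e : Expr) (c : Prog)

/-- `Exec c s t s'`: the program `c`, started in the state `s`, halts in the state `s'`, and the
total bit cost of this run is `t`. -/
inductive Exec : Prog → State → ℕ → State → Prop
  | skip (s : State) : Exec .skip s 1 s
  | assign (s : State) (x : ℕ) (e : Expr) :
      Exec (.assign x e) s (1 + e.cost s + bitSize (e.eval s)) (s.setReg x (e.eval s))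
  | store (s : State) (a : ℕ) (i e : Expr) :
      Exec (.store a i e) s
        (1 + i.cost s + e.cost s + bitSize (i.eval s) + bitSize (e.eval s))
        (s.setArr a (i.eval s) (e.eval s))
  | seq {c d : Prog} {s s' s'' : State} {t t' : ℕ} :
      Exec c s t s' → Exec d s' t' s'' → Exec (.seq c d) s (1 + t + t') s''
  | ite_pos {e : Expr} {c d : Prog} {s s' : State} {t : ℕ} :
      0 < e.eval s → Exec c s t s' → Exec (.ite e c d) s (1 + e.cost s + t) s'
  | ite_neg {e : Expr} {c d : Prog} {s s' : State} {t : ℕ} :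
      ¬ 0 < e.eval s → Exec d s t s' → Exec (.ite e c d) s (1 + e.cost s + t) s'
  | loop_stop {e : Expr} {c : Prog} {s : State} :
      ¬ 0 < e.eval s → Exec (.loop e c) s (1 + e.cost s) s
  | loop_step {e : Expr} {c : Prog} {s s' s'' : State} {t t' : ℕ} :
      0 < e.eval s → Exec c s t s' → Exec (.loop e c) s' t' s'' →
        Exec (.loop e c) s (1 + e.cost s + t + t') s''

/-- Programs are deterministic: the run from a given state, its cost and its final state are
unique. -/
theorem Exec.unique {c : Prog} {s s₁ s₂ : State} {t₁ t₂ : ℕ}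
    (h₁ : Exec c s t₁ s₁) (h₂ : Exec c s t₂ s₂) : t₁ = t₂ ∧ s₁ = s₂ := by
  induction h₁ generalizing t₂ s₂ with
  | skip s => cases h₂; exact ⟨rfl, rfl⟩
  | assign s x e => cases h₂; exact ⟨rfl, rfl⟩
  | store s a i e => cases h₂; exact ⟨rfl, rfl⟩
  | seq _ _ ih ih' =>
    cases h₂ with
    | seq k k' =>
      obtain ⟨rfl, rfl⟩ := ih k
      obtain ⟨rfl, rfl⟩ := ih' k'
      exact ⟨rfl, rfl⟩
  | ite_pos h _ ih =>
    cases h₂ with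
    | ite_pos _ k => obtain ⟨rfl, rfl⟩ := ih k; exact ⟨rfl, rfl⟩
    | ite_neg h' _ => exact absurd h h'
  | ite_neg h _ ih =>
    cases h₂ with
    | ite_pos h' _ => exact absurd h' h
    | ite_neg _ k => obtain ⟨rfl, rfl⟩ := ih k; exact ⟨rfl, rfl⟩
  | loop_stop h =>
    cases h₂ with
    | loop_stop _ => exact ⟨rfl, rfl⟩
    | loop_step h' _ _ => exact absurd h' h
  | loop_step h _ _ ih ih' =>
    cases h₂ with
    | loop_stop h' => exact absurd h h'
    | loop_step _ k k' =>
      obtain ⟨rfl, rfl⟩ := ih k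
      obtain ⟨rfl, rfl⟩ := ih' k'
      exact ⟨rfl, rfl⟩

/-- The state `s` holds the input `(A, b)`: the dimensions `m` and `n` in registers 0 and 1, the
entries of `A` row by row in array 0, and the entries of `b` in array 1. All other registers and
cells may hold anything. -/
def IsInput {m n : ℕ} (A : Matrix (Fin m) (Fin n) ℤ) (b : Fin m → ℤ) (s : State) : Prop :=
  s.reg 0 = m ∧ s.reg 1 = n ∧
    (∀ (i : Fin m) (j : Fin n), s.arr 0 ((i : ℤ) * n + j) = A i j) ∧
    ∀ i : Fin m, s.arr 1 (i : ℤ) = b i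

/-- The state `s` holds the output: `none` ("no solution") is the answer `0` in register 0, and
`some (x₀, x)` is the answer `1` in register 0 with `x₀` in register 1 and the entries of `x` in
array 2. -/
def IsOutput {n : ℕ} (out : Option (ℤ × (Fin n → ℤ))) (s : State) : Prop :=
  match out with
  | none => s.reg 0 = 0
  | some (x₀, x) => s.reg 0 = 1 ∧ s.reg 1 = x₀ ∧ ∀ j : Fin n, s.arr 2 (j : ℤ) = x j

/-- Every instance is held by some state. -/
theorem exists_isInput {m n : ℕ} (A : Matrix (Fin m) (Fin n) ℤ) (b : Fin m → ℤ) :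
    ∃ s, IsInput A b s := by
  classical
  have hinj : Function.Injective
      (fun p : Fin m × Fin n => (p.1 : ℤ) * n + p.2) := by
    intro p q h
    apply finProdFinEquiv.injective
    ext
    simp only [finProdFinEquiv_apply_val]
    have h' : ((p.1 : ℤ) * n + p.2) = (q.1 : ℤ) * n + q.2 := h
    zify
    linarith
  have hinj' : Function.Injective (fun i : Fin m => (i : ℤ)) := by
    intro i i' h
    ext
    have h' : (i : ℤ) = (i' : ℤ) := h
    exact_mod_cast h'
  refine ⟨⟨fun k => if k = 0 then m else n, fun k => if k = 0 then
    Function.extend (fun p : Fin m × Fin n => (p.1 : ℤ) * n + p.2) (fun p => A p.1 p.2) 0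
    else Function.extend (fun i : Fin m => (i : ℤ)) b 0⟩, by simp, by simp, ?_, ?_⟩
  · intro i j
    simpa using hinj.extend_apply (fun p => A p.1 p.2) 0 (i, j)
  · intro i
    simpa using hinj'.extend_apply b 0 i

end BitRAM

/-- `x` is a real solution of the system `A x = b`. -/
def IsRealSolution {m n : ℕ} (A : Matrix (Fin m) (Fin n) ℤ) (b : Fin m → ℤ)
    (x : Fin n → ℝ) : Prop :=
  A.map (fun a : ℤ => (a : ℝ)) *ᵥ x = fun i => (b i : ℝ)

/-- `out` is a correct answer for the system `A x = b`: `some (x₀, x)` is correct if `x₀ ≠ 0` and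
`x / x₀` is a solution, and `none` is correct if there is no real solution. -/
def IsCorrectAnswer {m n : ℕ} (A : Matrix (Fin m) (Fin n) ℤ) (b : Fin m → ℤ)
    (out : Option (ℤ × (Fin n → ℤ))) : Prop :=
  match out with
  | none => ¬ ∃ x : Fin n → ℝ, IsRealSolution A b x
  | some (x₀, x) => x₀ ≠ 0 ∧ IsRealSolution A b (fun j => (x j : ℝ) / (x₀ : ℝ))

/-! The algorithm is fraction-free Gauss–Jordan elimination, controlled by Cramer's rule. A
nonsingular integer matrix `E`, at first the identity, is kept only implicitly: memory holds `det
E`, `adj(E) A` and `adj(E) b`. If row `r` of `adj(E) A` has a nonzero entry in column `c`, then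
column `r` of `E` is replaced by column `c` of `A`. That entry is the new determinant, and
`Matrix.cramer_updateCol_mul_det` yields all other new entries by an exact division by the old
determinant. If row `r` vanishes, it is passed over; should `adj(E) b` be nonzero there, row `r` of
`adj(E)` annihilates `A` but not `b`, and the system is infeasible (`not_exists_isRealSolution`). If
this never happens, the identity `E (adj(E) b) = det(E) b` writes `det(E) b` as a combination of
columns of `A`, because the coordinates in passed rows are zero (`Stage.isRealSolution`).

The time bound rests on the fact that the stored entries are determinants of matrices with entries
from `A`, `b` and the identity, hence have about `m (m + S)` bits when the data have `S` bits
(`Matrix.natAbs_cramer_le`); intermediate values are only slightly longer. The judgement `Runs`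
carries correctness and cost together: it counts commands, of which there are polynomially many, in
a unit that bounds the price of one command on numbers of `L` bits. -/

/-! ### Bit sizes, and the values and costs of expressions -/

theorem bitSize_le_of_natAbs_le {a : ℤ} {k : ℕ} (h : a.natAbs ≤ 2 ^ k) : bitSize a ≤ k + 2 := by
  have h2 : Nat.clog 2 (a.natAbs + 1) ≤ k + 1 := by
    apply Nat.clog_le_of_le_pow
    have := Nat.one_le_two_pow (n := k)
    rw [pow_succ]
    omega
  unfold bitSize
  omega

theorem natAbs_le_two_pow_bitSize (a : ℤ) : a.natAbs ≤ 2 ^ bitSize a := by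
  have h := Nat.le_pow_clog (b := 2) (by norm_num) (a.natAbs + 1)
  unfold bitSize
  rw [pow_succ]
  omega

theorem one_le_bitSize (a : ℤ) : 1 ≤ bitSize a := by
  unfold bitSize
  omega

namespace BitRAM

/-- The syntactic weight of an expression, which controls the growth of its value. -/
def Expr.weight : Expr → ℕ
  | .const c => c.natAbs + 1
  | .reg _ => 1
  | .arr _ i => i.weight + 1
  | .add e f => e.weight + f.weight
  | .sub e f => e.weight + f.weight
  | .mul e f => e.weight + f.weight
  | .div e f => e.weight + f.weight

/-- All registers and cells that `e` reads in the state `s` hold numbers of absolute value at most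
`2 ^ L`. -/
def Expr.Small (s : State) (L : ℕ) : Expr → Prop
  | .const _ => True
  | .reg x => (s.reg x).natAbs ≤ 2 ^ L
  | .arr a i => i.Small s L ∧ (s.arr a (i.eval s)).natAbs ≤ 2 ^ L
  | .add e f => e.Small s L ∧ f.Small s L
  | .sub e f => e.Small s L ∧ f.Small s L
  | .mul e f => e.Small s L ∧ f.Small s L
  | .div e f => e.Small s L ∧ f.Small s L

theorem Expr.one_le_weight (e : Expr) : 1 ≤ e.weight := by
  induction e <;> simp only [Expr.weight] <;> omega

theorem two_pow_add_two_pow_le {a b : ℕ} (ha : 1 ≤ a) (hb : 1 ≤ b) :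
    2 ^ a + 2 ^ b ≤ 2 ^ (a + b) := by
  have h1 : 2 ≤ 2 ^ a := by simpa using Nat.pow_le_pow_right (n := 2) (by norm_num) ha
  have h2 : 2 ≤ 2 ^ b := by simpa using Nat.pow_le_pow_right (n := 2) (by norm_num) hb
  rw [pow_add]
  nlinarith

/-- Exponents add under products, and also under sums once both are positive
(`two_pow_add_two_pow_le`), which is what `1 ≤ L` ensures. Quotients do not exceed their dividends.
-/
theorem Expr.natAbs_eval_le {s : State} {L : ℕ} (hL : 1 ≤ L) {e : Expr} (h : e.Small s L) :
    (e.eval s).natAbs ≤ 2 ^ (e.weight * L) := by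
  induction e with
  | const c =>
    simp only [Expr.eval, Expr.weight]
    calc c.natAbs ≤ 2 ^ c.natAbs := Nat.lt_two_pow_self.le
      _ ≤ _ := Nat.pow_le_pow_right (by norm_num)
          ((Nat.le_succ _).trans (Nat.le_mul_of_pos_right _ hL))
  | reg x => simpa [Expr.eval, Expr.weight, Expr.Small] using h
  | arr a i _ =>
    refine h.2.trans (Nat.pow_le_pow_right (by norm_num) ?_)
    simp only [Expr.weight]
    nlinarith
  | add e f he hf =>
    simp only [Expr.eval, Expr.weight, add_mul]
    refine (Int.natAbs_add_le _ _).trans ((add_le_add (he h.1) (hf h.2)).trans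
      (two_pow_add_two_pow_le ?_ ?_)) <;> exact Nat.mul_pos (Expr.one_le_weight _) hL
  | sub e f he hf =>
    simp only [Expr.eval, Expr.weight, add_mul]
    refine (Int.natAbs_sub_le _ _).trans ((add_le_add (he h.1) (hf h.2)).trans
      (two_pow_add_two_pow_le ?_ ?_)) <;> exact Nat.mul_pos (Expr.one_le_weight _) hL
  | mul e f he hf =>
    simp only [Expr.eval, Expr.weight, add_mul, pow_add, Int.natAbs_mul]
    exact Nat.mul_le_mul (he h.1) (hf h.2)
  | div e f he hf =>
    simp only [Expr.eval, Expr.weight, add_mul]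
    exact (Int.natAbs_ediv_le_natAbs _ _).trans ((he h.1).trans
      (Nat.pow_le_pow_right (by norm_num) (Nat.le_add_right _ _)))

theorem Expr.bitSize_eval_le {s : State} {L : ℕ} (hL : 1 ≤ L) {e : Expr} (h : e.Small s L) :
    bitSize (e.eval s) ≤ 3 * (e.weight * L) := by
  have h1 := bitSize_le_of_natAbs_le (Expr.natAbs_eval_le hL h)
  have h2 : 1 ≤ e.weight * L := Nat.mul_pos e.one_le_weight hL
  omega

/-- For subexpressions with `weight * L` equal to `a` and `b`, the square `9 (a + b) ^ 2` leaves a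
cross term `18 a b` after paying for both. It covers the top operation, which costs at most `3 a * 3
b` for a product or quotient and `3 a + 3 b` for a sum or difference. -/
theorem Expr.cost_le {s : State} {L : ℕ} (hL : 1 ≤ L) {e : Expr} (h : e.Small s L) :
    e.cost s ≤ 9 * (e.weight * L) ^ 2 := by
  induction e with
  | const c =>
    have h1 := Expr.bitSize_eval_le hL h
    have h2 : 1 ≤ (Expr.const c).weight * L := Nat.mul_pos (Expr.one_le_weight _) hL
    simp only [Expr.cost, Expr.eval] at h1 ⊢
    nlinarith
  | reg x =>
    have h1 := Expr.bitSize_eval_le hL h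
    have h2 : 1 ≤ (Expr.reg x).weight * L := Nat.mul_pos (Expr.one_le_weight _) hL
    simp only [Expr.cost, Expr.eval] at h1 ⊢
    nlinarith
  | arr a i hi =>
    have h1 := Expr.bitSize_eval_le hL h.1
    have h2 : 1 ≤ i.weight * L := Nat.mul_pos (Expr.one_le_weight _) hL
    have h3 := hi h.1
    have h4 := bitSize_le_of_natAbs_le h.2
    simp only [Expr.cost, Expr.weight, add_mul, one_mul]
    nlinarith
  | add e f he hf =>
    have h1 := Expr.bitSize_eval_le hL h.1
    have h2 := Expr.bitSize_eval_le hL h.2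
    have h3 : 1 ≤ e.weight * L := Nat.mul_pos (Expr.one_le_weight _) hL
    have h4 : 1 ≤ f.weight * L := Nat.mul_pos (Expr.one_le_weight _) hL
    have h5 := he h.1
    have h6 := hf h.2
    simp only [Expr.cost, Expr.weight, add_mul]
    nlinarith
  | sub e f he hf =>
    have h1 := Expr.bitSize_eval_le hL h.1
    have h2 := Expr.bitSize_eval_le hL h.2
    have h3 : 1 ≤ e.weight * L := Nat.mul_pos (Expr.one_le_weight _) hL
    have h4 : 1 ≤ f.weight * L := Nat.mul_pos (Expr.one_le_weight _) hL
    have h5 := he h.1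
    have h6 := hf h.2
    simp only [Expr.cost, Expr.weight, add_mul]
    nlinarith
  | mul e f he hf =>
    have h1 := Nat.mul_le_mul (Expr.bitSize_eval_le hL h.1) (Expr.bitSize_eval_le hL h.2)
    have h5 := he h.1
    have h6 := hf h.2
    simp only [Expr.cost, Expr.weight, add_mul]
    nlinarith
  | div e f he hf =>
    have h1 := Nat.mul_le_mul (Expr.bitSize_eval_le hL h.1) (Expr.bitSize_eval_le hL h.2)
    have h5 := he h.1
    have h6 := hf h.2
    simp only [Expr.cost, Expr.weight, add_mul]
    nlinarith

/-! ### A program logic with costs -/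

/-- Started in `s`, the program `c` halts in a state that satisfies `Q`, at a cost of at most
`k` units of `3000 * L ^ 2`. -/
def Runs (L : ℕ) (c : Prog) (s : State) (k : ℕ) (Q : State → Prop) : Prop :=
  ∃ t s', Exec c s t s' ∧ t ≤ k * (3000 * L ^ 2) ∧ Q s'

theorem Runs.mono {L : ℕ} {c : Prog} {s : State} {k k' : ℕ} {Q Q' : State → Prop}
    (h : Runs L c s k Q) (hk : k ≤ k') (hQ : ∀ s', Q s' → Q' s') : Runs L c s k' Q' := by
  obtain ⟨t, s', he, ht, hq⟩ := h
  exact ⟨t, s', he, ht.trans (Nat.mul_le_mul_right _ hk), hQ _ hq⟩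

theorem Runs.skip {L : ℕ} (hL : 1 ≤ L) {s : State} {Q : State → Prop} (h : Q s) :
    Runs L .skip s 1 Q :=
  ⟨1, s, .skip s, by nlinarith, h⟩

theorem Runs.assign {L : ℕ} (hL : 1 ≤ L) {s : State} {x : ℕ} {e : Expr} {Q : State → Prop}
    (hw : e.weight ≤ 14) (he : e.Small s L) (h : Q (s.setReg x (e.eval s))) :
    Runs L (.assign x e) s 1 Q := by
  refine ⟨_, _, .assign s x e, ?_, h⟩
  have h1 := Expr.cost_le hL he
  have h2 := Expr.bitSize_eval_le hL he
  have h3 : e.weight * L ≤ 14 * L := Nat.mul_le_mul_right _ hw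
  have h4 := Nat.pow_le_pow_left h3 2
  nlinarith

/-- The dearest single command: `9 * 14 ^ 2 + 9 * 5 ^ 2` for the two evaluations and `3 * 14 + 3 * 5
+ 1` for the rest, in multiples of `L ^ 2`, is below the unit `3000`. -/
theorem Runs.store {L : ℕ} (hL : 1 ≤ L) {s : State} {a : ℕ} {i e : Expr} {Q : State → Prop}
    (hwi : i.weight ≤ 5) (hi : i.Small s L) (hw : e.weight ≤ 14) (he : e.Small s L)
    (h : Q (s.setArr a (i.eval s) (e.eval s))) : Runs L (.store a i e) s 1 Q := by
  refine ⟨_, _, .store s a i e, ?_, h⟩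
  have h1 := Expr.cost_le hL he
  have h2 := Expr.bitSize_eval_le hL he
  have h3 : e.weight * L ≤ 14 * L := Nat.mul_le_mul_right _ hw
  have h4 := Nat.pow_le_pow_left h3 2
  have h5 := Expr.cost_le hL hi
  have h6 := Expr.bitSize_eval_le hL hi
  have h7 : i.weight * L ≤ 5 * L := Nat.mul_le_mul_right _ hwi
  have h8 := Nat.pow_le_pow_left h7 2
  nlinarith

theorem Runs.seq {L : ℕ} (hL : 1 ≤ L) {c d : Prog} {s : State} {k k' : ℕ} {Q Q' : State → Prop}
    (h : Runs L c s k Q) (h' : ∀ s', Q s' → Runs L d s' k' Q') :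
    Runs L (.seq c d) s (k + k' + 1) Q' := by
  obtain ⟨t, s', he, ht, hq⟩ := h
  obtain ⟨t', s'', he', ht', hq'⟩ := h' s' hq
  exact ⟨_, _, .seq he he', by nlinarith, hq'⟩

theorem Expr.one_add_cost_le {L : ℕ} (hL : 1 ≤ L) {s : State} {e : Expr}
    (hw : e.weight ≤ 14) (he : e.Small s L) : 1 + e.cost s ≤ 3000 * L ^ 2 := by
  have h1 := Expr.cost_le hL he
  have h3 : e.weight * L ≤ 14 * L := Nat.mul_le_mul_right _ hw
  have h4 := Nat.pow_le_pow_left h3 2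
  nlinarith

theorem Runs.ite {L : ℕ} (hL : 1 ≤ L) {s : State} {e : Expr} {c d : Prog} {k : ℕ}
    {Q : State → Prop} (hw : e.weight ≤ 14) (he : e.Small s L)
    (hc : 0 < e.eval s → Runs L c s k Q) (hd : ¬ 0 < e.eval s → Runs L d s k Q) :
    Runs L (.ite e c d) s (k + 1) Q := by
  have h1 := Expr.one_add_cost_le hL hw he
  by_cases h : 0 < e.eval s
  · obtain ⟨t, s', hx, ht, hq⟩ := hc h
    exact ⟨_, _, .ite_pos h hx, by linarith, hq⟩
  · obtain ⟨t, s', hx, ht, hq⟩ := hd h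
    exact ⟨_, _, .ite_neg h hx, by linarith, hq⟩

/-- Run `c` with the register `x` counting from `0` up to the value of `e`. -/
def Prog.countUp (x : ℕ) (e : Expr) (c : Prog) : Prog :=
  .seq (.assign x (.const 0))
    (.loop (.sub e (.reg x)) (.seq c (.assign x (.add (.reg x) (.const 1)))))

/-- The usual invariant rule. The body must give the counter back unchanged and the invariant must
survive any write to it. A round costs the body plus three units (test, increment, composition); the
last `3` pays for the initialization, its composition and the failing test. -/
theorem Runs.countUp {L : ℕ} (hL : 1 ≤ L) {s : State} {x : ℕ} {e : Expr} {c : Prog} {k N : ℕ}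
    (I : ℕ → State → Prop) (hw : e.weight ≤ 13) (hN : N ≤ 2 ^ L)
    (he : ∀ i s, I i s → e.Small s L ∧ e.eval s = N)
    (hI : ∀ i s v, I i s → I i (s.setReg x v)) (h0 : I 0 s)
    (hc : ∀ i < N, ∀ s, I i s → s.reg x = i →
      Runs L c s k (fun s' => s'.reg x = i ∧ I (i + 1) s')) :
    Runs L (.countUp x e c) s (N * (k + 3) + 3) (I N) := by
  have key : ∀ j i s, i + j = N → I i s → s.reg x = i →
      Runs L (.loop (.sub e (.reg x)) (.seq c (.assign x (.add (.reg x) (.const 1))))) s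
        (j * (k + 3) + 1) (I N) := by
    intro j
    induction j with
    | zero =>
      intro i s hij hi hx
      obtain rfl : i = N := by omega
      obtain ⟨hs, hv⟩ := he _ _ hi
      refine ⟨_, _, Exec.loop_stop ?_, ?_, hi⟩
      · simp [Expr.eval, hv, hx]
      · have := Expr.one_add_cost_le (e := .sub e (.reg x)) hL
          (by simp only [Expr.weight]; omega) ⟨hs, by simpa [Expr.Small, hx] using hN⟩
        linarith
    | succ j ih =>
      intro i s hij hi hx
      obtain ⟨hs, hv⟩ := he _ _ hi
      have hsm : (i : ℤ).natAbs ≤ 2 ^ L := by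
        rw [Int.natAbs_natCast]; omega
      have h1 := Expr.one_add_cost_le (e := .sub e (.reg x)) (s := s) hL
          (by simp only [Expr.weight]; omega) ⟨hs, by simpa [Expr.Small, hx] using hsm⟩
      have h2 : Runs L (.seq c (.assign x (.add (.reg x) (.const 1)))) s (k + 1 + 1)
          (fun s' => s'.reg x = ((i + 1 : ℕ) : ℤ) ∧ I (i + 1) s') := by
        refine Runs.seq hL (hc i (by omega) s hi hx) ?_
        rintro s' ⟨hx', hi'⟩
        refine Runs.assign hL (by simp [Expr.weight])
          ⟨by simpa [Expr.Small, hx'] using hsm, trivial⟩ ⟨?_, hI _ _ _ hi'⟩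
        simp [State.setReg, Expr.eval, hx']
      obtain ⟨t, s', hx1, ht, hx', hi'⟩ := h2
      obtain ⟨t', s'', hx2, ht', hq⟩ := ih (i + 1) s' (by omega) hi' hx'
      refine ⟨_, _, .loop_step ?_ hx1 hx2, ?_, hq⟩
      · simp only [Expr.eval, hv, hx]; omega
      · rw [add_mul] at ht' ⊢
        rw [add_one_mul, add_mul (j * (k + 3))]
        linarith
  refine (Runs.seq hL (Q := fun s' => I 0 s' ∧ s'.reg x = (0 : ℕ)) (k := 1)
    (Runs.assign (e := .const 0) hL (by simp [Expr.weight]) trivial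
      ⟨hI _ _ _ h0, by simp [State.setReg, Expr.eval]⟩)
    (fun s' hs' => key N 0 s' (by omega) hs'.1 hs'.2)).mono (by omega) (fun _ h => h)

end BitRAM

/-! ### Exchanging a column in Cramer's rule, and determinant bounds -/

theorem Matrix.updateCol_mulVec_eq {m : ℕ} (E : Matrix (Fin m) (Fin m) ℤ) (r : Fin m)
    (u x : Fin m → ℤ) :
    E.updateCol r u *ᵥ x = E *ᵥ x + x r • (u - fun k => E k r) := by
  ext k
  simp only [Matrix.mulVec, dotProduct, Pi.add_apply, Pi.smul_apply, Pi.sub_apply, smul_eq_mul,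
    Matrix.updateCol_apply]
  have h : ∀ i, (if i = r then u k else E k i) * x i =
      E k i * x i + if i = r then x r * (u k - E k r) else 0 := by
    intro i
    split_ifs with h
    · subst h; ring
    · ring
  simp [h, Finset.sum_add_distrib]

/-- The right-hand side, as a vector `x`, solves `E' x = E.det * E'.det * v` for the new matrix
`E'`, and so does the left-hand side by Cramer's rule. As `E'.det = E.cramer u r ≠ 0`, they agree.
-/
theorem Matrix.cramer_updateCol_mul_det {m : ℕ} (E : Matrix (Fin m) (Fin m) ℤ) (r : Fin m)
    (u v : Fin m → ℤ) (hp : E.cramer u r ≠ 0) (i : Fin m) :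
    E.det * (E.updateCol r u).cramer v i =
      E.cramer u r * E.cramer v i -
        (E.cramer u i - if i = r then E.det else 0) * E.cramer v r := by
  set x : Fin m → ℤ := E.cramer u r • E.cramer v -
    E.cramer v r • (E.cramer u - E.det • Pi.single r 1) with hx
  have hdet : (E.updateCol r u).det = E.cramer u r := (Matrix.cramer_apply E u r).symm
  have hxr : x r = E.det * E.cramer v r := by
    simp [hx]; ring
  have h1 : E.updateCol r u *ᵥ (E.det • (E.updateCol r u).cramer v - x) = 0 := by
    rw [Matrix.mulVec_sub, Matrix.mulVec_smul, Matrix.mulVec_cramer, hdet,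
      Matrix.updateCol_mulVec_eq, hxr, hx]
    simp only [Matrix.mulVec_sub, Matrix.mulVec_smul, Matrix.mulVec_cramer]
    ext k
    simp
    ring
  have h2 := congrFun (Matrix.eq_zero_of_mulVec_eq_zero (hdet ▸ hp) h1) i
  have h3 : E.det * (E.updateCol r u).cramer v i = x i := by
    simpa [sub_eq_zero] using h2
  rw [h3, hx]
  by_cases hi : i = r
  · subst hi; simp; ring
  · simp [hi]; ring

/-- The Leibniz expansion, with `m! ≤ m ^ m ≤ (2 ^ m) ^ m`. -/
theorem Matrix.natAbs_det_le {m S : ℕ} (E : Matrix (Fin m) (Fin m) ℤ)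
    (h : ∀ i j, (E i j).natAbs ≤ 2 ^ S) : E.det.natAbs ≤ 2 ^ (m * (m + S)) := by
  have h1 := Matrix.det_le (A := E) (abv := AbsoluteValue.abs) (x := 2 ^ S) (by
    intro i j
    have := h i j
    zify at this
    simpa using this)
  have h2 : E.det.natAbs ≤ m.factorial * (2 ^ S) ^ m := by
    zify
    simpa using h1
  have h3 : m.factorial ≤ (2 ^ m) ^ m :=
    (Nat.factorial_le_pow m).trans (Nat.pow_le_pow_left Nat.lt_two_pow_self.le _)
  calc E.det.natAbs ≤ (2 ^ m) ^ m * (2 ^ S) ^ m := h2.trans (Nat.mul_le_mul_right _ h3)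
    _ = 2 ^ (m * (m + S)) := by rw [← pow_mul, ← pow_mul, ← pow_add]; ring_nf

theorem Matrix.natAbs_cramer_le {m S : ℕ} (E : Matrix (Fin m) (Fin m) ℤ)
    (h : ∀ i j, (E i j).natAbs ≤ 2 ^ S) (v : Fin m → ℤ) (hv : ∀ i, (v i).natAbs ≤ 2 ^ S)
    (i : Fin m) : (E.cramer v i).natAbs ≤ 2 ^ (m * (m + S)) := by
  rw [Matrix.cramer_apply]
  apply Matrix.natAbs_det_le
  intro k j
  rw [Matrix.updateCol_apply]
  split_ifs
  exacts [hv k, h k j]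

/-! ### Correctness of the elimination -/

theorem isRealSolution_iff {m n : ℕ} {A : Matrix (Fin m) (Fin n) ℤ} {b : Fin m → ℤ}
    {x : Fin n → ℝ} : IsRealSolution A b x ↔ ∀ i, ∑ j, (A i j : ℝ) * x j = b i := by
  simp [IsRealSolution, funext_iff, Matrix.mulVec, dotProduct]

/-- Row `r` of the adjugate of `E` is a Fredholm certificate: it is orthogonal to every column of
`A` but not to `b`. -/
theorem not_exists_isRealSolution {m n : ℕ} {A : Matrix (Fin m) (Fin n) ℤ} {b : Fin m → ℤ}
    {E : Matrix (Fin m) (Fin m) ℤ} {r : Fin m} (hA : ∀ j, E.cramer (fun k => A k j) r = 0)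
    (hb : E.cramer b r ≠ 0) : ¬ ∃ x : Fin n → ℝ, IsRealSolution A b x := by
  rintro ⟨x, hx⟩
  rw [isRealSolution_iff] at hx
  apply hb
  have hA' : ∀ j, ∑ k, (E.adjugate r k : ℝ) * A k j = 0 := by
    intro j
    have := hA j
    rw [Matrix.cramer_eq_adjugate_mulVec] at this
    simp only [Matrix.mulVec, dotProduct] at this
    exact_mod_cast this
  rw [Matrix.cramer_eq_adjugate_mulVec]
  simp only [Matrix.mulVec, dotProduct]
  have h : ∑ k, (E.adjugate r k : ℝ) * b k = 0 := by
    calc ∑ k, (E.adjugate r k : ℝ) * b k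
        = ∑ k, ∑ j, (E.adjugate r k : ℝ) * A k j * x j := by
          refine Finset.sum_congr rfl fun k _ => ?_
          rw [← hx k, Finset.mul_sum]
          exact Finset.sum_congr rfl fun j _ => by ring
      _ = ∑ j, (∑ k, (E.adjugate r k : ℝ) * A k j) * x j := by
          rw [Finset.sum_comm]
          exact Finset.sum_congr rfl fun j _ => by rw [Finset.sum_mul]
      _ = 0 := by simp [hA']
  exact_mod_cast h

/-- The state of the elimination after the first `r` rows: `E` is the current basis matrix, and
column `i` of `E` is column `B i` of `A` if row `i` has been used as a pivot row, whereas
`B i = n` for the rows that have been passed over. -/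
structure Stage {m n : ℕ} (A : Matrix (Fin m) (Fin n) ℤ) (b : Fin m → ℤ) (S r : ℕ)
    (E : Matrix (Fin m) (Fin m) ℤ) (B : Fin m → ℕ) (flag : ℤ) : Prop where
  det_ne : E.det ≠ 0
  entry_le : ∀ i j, (E i j).natAbs ≤ 2 ^ S
  row : ∀ i : Fin m, (i : ℕ) < r →
    (∃ j : Fin n, B i = j ∧ ∀ k, E k i = A k j) ∨
    (B i = n ∧ (∀ j, E.cramer (fun k => A k j) i = 0) ∧ (flag = 0 → E.cramer b i = 0))
  flag_eq : flag = 0 ∨ (flag = 1 ∧ ¬ ∃ x : Fin n → ℝ, IsRealSolution A b x)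

theorem Stage.zero {m n : ℕ} (A : Matrix (Fin m) (Fin n) ℤ) (b : Fin m → ℤ) (S : ℕ)
    (B : Fin m → ℕ) : Stage A b S 0 1 B 0 where
  det_ne := by simp
  entry_le i j := by
    rw [Matrix.one_apply]
    split_ifs <;> simp [Nat.one_le_two_pow]
  row i hi := by omega
  flag_eq := Or.inl rfl

theorem Stage.pass {m n : ℕ} {A : Matrix (Fin m) (Fin n) ℤ} {b : Fin m → ℤ} {S : ℕ} {r : Fin m}
    {E : Matrix (Fin m) (Fin m) ℤ} {B : Fin m → ℕ} {flag flag' : ℤ} (h : Stage A b S r E B flag)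
    (hA : ∀ j, E.cramer (fun k => A k j) r = 0)
    (hf : (E.cramer b r = 0 ∧ flag' = flag) ∨ (E.cramer b r ≠ 0 ∧ flag' = 1)) :
    Stage A b S (r + 1) E (Function.update B r n) flag' where
  det_ne := h.det_ne
  entry_le := h.entry_le
  row i hi := by
    by_cases hir : i = r
    · subst hir
      refine Or.inr ⟨by simp, hA, fun h0 => ?_⟩
      rcases hf with hf | hf
      · exact hf.1
      · rw [hf.2] at h0; norm_num at h0
    · have hi' : (i : ℕ) < r := by
        have : (i : ℕ) ≠ r := fun h => hir (Fin.ext h)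
        omega
      rcases h.row i hi' with h1 | ⟨h1, h2, h3⟩
      · exact Or.inl (by simpa [hir] using h1)
      · refine Or.inr ⟨by simpa [hir] using h1, h2, fun h0 => ?_⟩
        rcases hf with hf | hf
        · exact h3 (hf.2 ▸ h0)
        · rw [hf.2] at h0; norm_num at h0
  flag_eq := by
    rcases hf with hf | hf
    · rw [hf.2]; exact h.flag_eq
    · exact Or.inr ⟨hf.2, not_exists_isRealSolution hA hf.1⟩

theorem Stage.pivot {m n : ℕ} {A : Matrix (Fin m) (Fin n) ℤ} {b : Fin m → ℤ} {S : ℕ} {r : Fin m}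
    {E : Matrix (Fin m) (Fin m) ℤ} {B : Fin m → ℕ} {flag : ℤ} (h : Stage A b S r E B flag)
    (hS : ∀ i j, (A i j).natAbs ≤ 2 ^ S) {c : Fin n}
    (hc : E.cramer (fun k => A k c) r ≠ 0) :
    Stage A b S (r + 1) (E.updateCol r fun k => A k c) (Function.update B r c) flag where
  det_ne := by rwa [← Matrix.cramer_apply]
  entry_le i j := by
    rw [Matrix.updateCol_apply]
    split_ifs
    exacts [hS _ _, h.entry_le _ _]
  row i hi := by
    by_cases hir : i = r
    · subst hir
      exact Or.inl ⟨c, by simp⟩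
    · have hi' : (i : ℕ) < r := by
        have : (i : ℕ) ≠ r := fun h => hir (Fin.ext h)
        omega
      rcases h.row i hi' with h1 | ⟨h1, h2, h3⟩
      · exact Or.inl (by simpa [hir] using h1)
      -- A row passed over earlier stays zero: in the exchange formula both `E.cramer v i` and the
      -- multiplier `E.cramer u i` vanish, and `E.det` cancels.
      · have key : ∀ v, E.cramer v i = 0 →
            (E.updateCol r fun k => A k c).cramer v i = 0 := by
          intro v hv
          have := Matrix.cramer_updateCol_mul_det E r (fun k => A k c) v hc i
          rw [hv, h2 c] at this
          simpa [hir, h.det_ne] using this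
        exact Or.inr ⟨by simpa [hir] using h1, fun j => key _ (h2 j), fun h0 => key _ (h3 h0)⟩
  flag_eq := h.flag_eq

/-- In `E *ᵥ E.cramer b = E.det • b`, each coordinate either multiplies a column of `A` or is zero.
The pivot columns need not be known to be distinct, since `x j` sums over all rows assigned to `j`.
-/
theorem Stage.isRealSolution {m n : ℕ} {A : Matrix (Fin m) (Fin n) ℤ} {b : Fin m → ℤ} {S : ℕ}
    {E : Matrix (Fin m) (Fin m) ℤ} {B : Fin m → ℕ} (h : Stage A b S m E B 0) {x : Fin n → ℤ}
    (hx : ∀ j : Fin n, x j = ∑ i, if B i = j then E.cramer b i else 0) :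
    IsRealSolution A b (fun j => (x j : ℝ) / (E.det : ℝ)) := by
  rw [isRealSolution_iff]
  intro k
  have hd : (E.det : ℝ) ≠ 0 := by exact_mod_cast h.det_ne
  have h1 : ∑ j, A k j * x j = E.det * b k := by
    have h2 := congrFun (Matrix.mulVec_cramer E b) k
    simp only [Matrix.mulVec, dotProduct, Pi.smul_apply, smul_eq_mul] at h2
    rw [← h2]
    simp only [hx, Finset.mul_sum]
    rw [Finset.sum_comm]
    refine Finset.sum_congr rfl fun i _ => ?_
    rcases h.row i i.2 with ⟨j, hj, hE⟩ | ⟨hj, -, h0⟩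
    · rw [Finset.sum_eq_single j]
      · simp [hj, hE]
      · intro j' _ hj'
        have : (j : ℕ) ≠ j' := fun h => hj' (Fin.ext h.symm)
        simp [hj, this]
      · simp
    · simp [h0 rfl]
  have h2 : ∑ j, (A k j : ℝ) * x j = E.det * b k := by exact_mod_cast h1
  simp only [mul_div_assoc']
  rw [← Finset.sum_div, h2]
  field_simp

/-! ### The program and its memory layout -/

namespace BitRAM

/-- The entry of the matrix in array 0 in the row given by register `i` and the column given by
register `j`. -/
def Expr.index (i j : ℕ) : Expr := .add (.mul (.reg i) (.reg 1)) (.reg j)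

/-- The combination `(p * x - f * y) / d` with `p`, `f`, `d` in registers 7, 8, 6. -/
def Expr.combine (x y : Expr) : Expr :=
  .div (.sub (.mul (.reg 7) x) (.mul (.reg 8) y)) (.reg 6)

/-- Put into register 5 a column with a nonzero entry in the row given by register 2, or the number
of columns if that row is zero. -/
def Prog.search : Prog :=
  .seq (.assign 5 (.reg 1)) (.countUp 4 (.reg 1)
    (.ite (.mul (.arr 0 (.index 2 4)) (.arr 0 (.index 2 4))) (.assign 5 (.reg 4)) .skip))

/-- Update the row given by register 3, when pivoting on the row given by register 2 and the column
given by register 5. -/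
def Prog.updateRow : Prog :=
  .seq (.assign 8 (.arr 0 (.index 3 5)))
    (.seq (.ite (.mul (.sub (.reg 3) (.reg 2)) (.sub (.reg 3) (.reg 2))) .skip
        (.assign 8 (.sub (.reg 8) (.reg 6))))
      (.seq (.countUp 4 (.reg 1)
          (.store 0 (.index 3 4) (.combine (.arr 0 (.index 3 4)) (.arr 0 (.index 2 4)))))
        (.store 1 (.reg 3) (.combine (.arr 1 (.reg 3)) (.arr 1 (.reg 2))))))

/-- Pivot on the row given by register 2 and the column given by register 5. -/
def Prog.pivot : Prog :=
  .seq (.assign 7 (.arr 0 (.index 2 5)))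
    (.seq (.countUp 3 (.reg 0) .updateRow) (.assign 6 (.reg 7)))

/-- Process the row given by register 2. -/
def Prog.processRow : Prog :=
  .seq .search (.seq (.store 3 (.reg 2) (.reg 5))
    (.ite (.sub (.reg 1) (.reg 5)) .pivot
      (.ite (.mul (.arr 1 (.reg 2)) (.arr 1 (.reg 2))) (.assign 9 (.const 1)) .skip)))

/-- Eliminate: determinant in register 6, infeasibility flag in register 9. -/
def Prog.eliminate : Prog :=
  .seq (.assign 6 (.const 1)) (.seq (.assign 9 (.const 0)) (.countUp 2 (.reg 0) .processRow))

/-- Read off the answer after the elimination. -/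
def Prog.readOff : Prog :=
  .seq (.countUp 4 (.add (.reg 1) (.const 1)) (.store 2 (.reg 4) (.const 0)))
    (.seq (.countUp 2 (.reg 0) (.store 2 (.arr 3 (.reg 2))
        (.add (.arr 2 (.arr 3 (.reg 2))) (.arr 1 (.reg 2)))))
      (.seq (.assign 1 (.reg 6)) (.assign 0 (.sub (.const 1) (.reg 9)))))

/-- The state `s` holds the matrix `F` and the vector `G`. -/
structure Holds {m n : ℕ} (F : Fin m → Fin n → ℤ) (G : Fin m → ℤ) (s : State) : Prop where
  rows : s.reg 0 = m
  cols : s.reg 1 = n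
  mat : ∀ (i : Fin m) (j : Fin n), s.arr 0 ((i : ℤ) * n + j) = F i j
  vec : ∀ i : Fin m, s.arr 1 (i : ℤ) = G i

variable {m n : ℕ} {F : Fin m → Fin n → ℤ} {G : Fin m → ℤ} {s s' : State}

theorem Holds.congr (h : Holds F G s) (h0 : s'.reg 0 = s.reg 0) (h1 : s'.reg 1 = s.reg 1)
    (ha : s'.arr 0 = s.arr 0) (ha' : s'.arr 1 = s.arr 1) : Holds F G s' where
  rows := h0.trans h.rows
  cols := h1.trans h.cols
  mat := ha ▸ h.mat
  vec := ha' ▸ h.vec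

theorem Holds.setReg (h : Holds F G s) {x : ℕ} (hx : 2 ≤ x) (v : ℤ) : Holds F G (s.setReg x v) :=
  h.congr (by simp [State.setReg, Function.update_apply]; omega)
    (by simp [State.setReg, Function.update_apply]; omega) rfl rfl

theorem Holds.setArr (h : Holds F G s) {a : ℕ} (ha : 2 ≤ a) (i v : ℤ) :
    Holds F G (s.setArr a i v) :=
  h.congr rfl rfl (by simp only [State.setArr]; rw [Function.update_of_ne (by omega)])
    (by simp only [State.setArr]; rw [Function.update_of_ne (by omega)])

theorem index_inj {i i' : Fin m} {j j' : Fin n}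
    (h : (i : ℤ) * n + j = (i' : ℤ) * n + j') : i = i' ∧ j = j' := by
  have h1 : finProdFinEquiv (i, j) = finProdFinEquiv (i', j') := by
    ext
    simp only [finProdFinEquiv_apply_val]
    zify
    linarith
  simpa using finProdFinEquiv.injective h1

theorem Holds.setMat (h : Holds F G s) (i : Fin m) (j : Fin n) (v : ℤ) :
    Holds (fun i' j' => if i' = i ∧ j' = j then v else F i' j') G
      (s.setArr 0 ((i : ℤ) * n + j) v) where
  rows := h.rows
  cols := h.cols
  mat i' j' := by
    simp only [State.setArr, Function.update_self, Function.update_apply]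
    split_ifs with h1 h2 h2
    · rfl
    · exact absurd (index_inj h1) h2
    · rw [h2.1, h2.2] at h1; exact absurd rfl h1
    · exact h.mat i' j'
  vec i' := by simpa [State.setArr] using h.vec i'

theorem Holds.setVec (h : Holds F G s) (i : Fin m) (v : ℤ) :
    Holds F (fun i' => if i' = i then v else G i') (s.setArr 1 (i : ℤ) v) where
  rows := h.rows
  cols := h.cols
  mat i' j' := by simpa [State.setArr] using h.mat i' j'
  vec i' := by
    simp only [State.setArr, Function.update_self, Function.update_apply, Nat.cast_inj,
      Fin.val_inj]
    split_ifs
    · rfl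
    · exact h.vec i'

theorem Holds.eval_index (h : Holds F G s) {x y : ℕ} {i : Fin m} {j : Fin n}
    (hx : s.reg x = (i : ℕ)) (hy : s.reg y = (j : ℕ)) :
    (Expr.index x y).eval s = (i : ℤ) * n + j := by
  simp [Expr.index, Expr.eval, hx, hy, h.cols]

theorem Holds.small_index (h : Holds F G s) {x y : ℕ} {i : Fin m} {j : Fin n} {L : ℕ}
    (hx : s.reg x = (i : ℕ)) (hy : s.reg y = (j : ℕ)) (hm : m ≤ 2 ^ L) (hn : n ≤ 2 ^ L) :
    (Expr.index x y).Small s L := by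
  have := i.2
  have := j.2
  simp only [Expr.index, Expr.Small, hx, hy, h.cols, Int.natAbs_natCast]
  omega

/-- The states `s` and `s'` agree on all registers outside `X`. -/
def AgreeOff (X : List ℕ) (s s' : State) : Prop := ∀ y, y ∉ X → s'.reg y = s.reg y

theorem AgreeOff.setReg {X : List ℕ} (h : AgreeOff X s s') {x : ℕ} (hx : x ∈ X) (v : ℤ) :
    AgreeOff X s (s'.setReg x v) := by
  intro y hy
  have : y ≠ x := fun h => hy (h ▸ hx)
  simpa [State.setReg, this] using h y hy

/-! ### Runs of the search and of the pivot step -/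

theorem Runs.search {K L : ℕ} (hK : K + 1 ≤ L) (hm : m ≤ 2 ^ K) (hn : n ≤ 2 ^ K)
    (h : Holds F G s) (hF : ∀ i j, (F i j).natAbs ≤ 2 ^ K) {r : Fin m}
    (hr : s.reg 2 = (r : ℕ)) :
    Runs L .search s (n * 5 + 5) (fun s' => AgreeOff [4, 5] s s' ∧ s'.arr = s.arr ∧
      ((s'.reg 5 = n ∧ ∀ j, F r j = 0) ∨ ∃ c : Fin n, s'.reg 5 = (c : ℕ) ∧ F r c ≠ 0)) := by
  have hL : 1 ≤ L := by omega
  have hKL : 2 ^ K ≤ 2 ^ L := Nat.pow_le_pow_right (by norm_num) (by omega)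
  let I : ℕ → State → Prop := fun k s' => AgreeOff [4, 5] s s' ∧ s'.arr = s.arr ∧
      ((s'.reg 5 = n ∧ ∀ j : Fin n, (j : ℕ) < k → F r j = 0) ∨
        ∃ c : Fin n, s'.reg 5 = (c : ℕ) ∧ F r c ≠ 0)
  have hH : ∀ k s', I k s' → Holds F G s' := fun k s' hs =>
    h.congr (hs.1 0 (by decide)) (hs.1 1 (by decide)) (by rw [hs.2.1]) (by rw [hs.2.1])
  refine (Runs.seq hL (k := 1) (Q := I 0) ?_ fun s1 h1 =>
    Runs.countUp (N := n) (k := 2) hL I (by decide) (by omega) ?_ ?_ h1 ?_).mono (by omega) ?_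
  · refine Runs.assign hL (by decide) (by simp [Expr.Small, h.cols]; omega)
      ⟨?_, rfl, Or.inl ⟨?_, ?_⟩⟩
    · exact AgreeOff.setReg (fun _ _ => rfl) (by decide) _
    · simp [State.setReg, Expr.eval, h.cols]
    · intro j hj; omega
  · intro k s' hs
    have := (hH k s' hs).cols
    simp [Expr.Small, Expr.eval, this]
    omega
  · rintro k s' v ⟨h1, h2, h3⟩
    exact ⟨h1.setReg (by decide) v, h2, by simpa [State.setReg] using h3⟩
  · intro k hk s' hs h4
    have hH' := hH k s' hs
    have h2 : s'.reg 2 = (r : ℕ) := (hs.1 2 (by decide)).trans hr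
    have h4' : s'.reg 4 = ((⟨k, hk⟩ : Fin n) : ℕ) := h4
    have hv : (Expr.arr 0 (.index 2 4)).eval s' = F r ⟨k, hk⟩ := by
      rw [Expr.eval, hH'.eval_index h2 h4', hH'.mat]
    have hsm : (Expr.arr 0 (.index 2 4)).Small s' L :=
      ⟨hH'.small_index h2 h4' (by omega) (by omega), by
        rw [hH'.eval_index h2 h4', hH'.mat]; exact (hF _ _).trans hKL⟩
    -- Branching only tests positivity, so an entry is tested for being nonzero through its square.
    -- The scan does not stop at a hit; any nonzero column will do.
    refine Runs.ite hL (by decide) ⟨hsm, hsm⟩ (fun hpos => ?_) (fun hneg => ?_)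
    · refine Runs.assign hL (by decide) (by simp [Expr.Small, h4]; omega)
        ⟨by simp [State.setReg, h4], hs.1.setReg (by decide) _, hs.2.1,
          Or.inr ⟨⟨k, hk⟩, by simp [State.setReg, Expr.eval, h4], fun h0 => ?_⟩⟩
      rw [Expr.eval, hv, h0] at hpos
      simp at hpos
    · have h0 : F r ⟨k, hk⟩ = 0 := by
        rw [Expr.eval, hv] at hneg
        by_contra hne
        exact hneg (mul_self_pos.mpr hne)
      refine Runs.skip hL ⟨h4, hs.1, hs.2.1, ?_⟩
      rcases hs.2.2 with ⟨h5, h6⟩ | h5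
      · refine Or.inl ⟨h5, fun j hj => ?_⟩
        rcases Nat.lt_succ_iff_lt_or_eq.mp hj with hj | hj
        · exact h6 j hj
        · rw [← h0]; congr 1; exact Fin.ext hj
      · exact Or.inr h5
  · rintro s' ⟨h1, h2, h3⟩
    refine ⟨h1, h2, ?_⟩
    rcases h3 with ⟨h3, h4⟩ | h3
    · exact Or.inl ⟨h3, fun j => h4 j j.2⟩
    · exact Or.inr h3

/-- Lowering the multiplier by `d` in the pivot row makes the formula fix that row, so one formula
serves all rows. The multiplier is saved beforehand because the sweep overwrites column `c`. -/
theorem Runs.updateRow {K L : ℕ} (hK : K + 1 ≤ L) (hm : m ≤ 2 ^ K) (hn : n ≤ 2 ^ K)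
    (h : Holds F G s) (hF : ∀ i j, (F i j).natAbs ≤ 2 ^ K) (hG : ∀ i, (G i).natAbs ≤ 2 ^ K)
    {i r : Fin m} {c : Fin n} {d : ℤ} (hd : d ≠ 0) (hdK : d.natAbs ≤ 2 ^ K)
    (h2 : s.reg 2 = (r : ℕ)) (h3 : s.reg 3 = (i : ℕ)) (h5 : s.reg 5 = (c : ℕ))
    (h6 : s.reg 6 = d) (h7 : s.reg 7 = F r c) {f' : Fin n → ℤ} {g' : ℤ}
    (hf' : ∀ j, d * f' j = F r c * F i j - (F i c - if i = r then d else 0) * F r j)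
    (hg' : d * g' = F r c * G i - (F i c - if i = r then d else 0) * G r) :
    Runs L .updateRow s (n * 4 + 10) (fun s' => AgreeOff [4, 8] s s' ∧
      (∀ a, 2 ≤ a → s'.arr a = s.arr a) ∧
      Holds (fun i' j' => if i' = i then f' j' else F i' j')
        (fun i' => if i' = i then g' else G i') s') := by
  have hL : 1 ≤ L := by omega
  -- The multiplier may be a difference of two numbers bounded by `2 ^ K`; this is what the extra
  -- bit in `K + 1 ≤ L` is for.
  have hKL1 : 2 ^ K + 2 ^ K ≤ 2 ^ L :=
    calc 2 ^ K + 2 ^ K = 2 ^ (K + 1) := by rw [pow_succ]; omega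
      _ ≤ 2 ^ L := Nat.pow_le_pow_right (by norm_num) hK
  have hKL : 2 ^ K ≤ 2 ^ L := by omega
  have hi := i.2
  have hr := r.2
  set f : ℤ := F i c - if i = r then d else 0 with hfdef
  have hfK : f.natAbs ≤ 2 ^ L := by
    refine (Int.natAbs_sub_le _ _).trans (le_trans (add_le_add (hF i c) ?_) hKL1)
    split_ifs
    · exact hdK
    · simp
  let I : ℕ → State → Prop := fun k s' => AgreeOff [4, 8] s s' ∧
      (∀ a, 2 ≤ a → s'.arr a = s.arr a) ∧ s'.reg 8 = f ∧
      Holds (fun i' j' => if i' = i ∧ (j' : ℕ) < k then f' j' else F i' j') G s'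
  refine (Runs.seq hL (k := 1) (Q := fun s' => AgreeOff [4, 8] s s' ∧ s'.arr = s.arr ∧
      s'.reg 8 = F i c) ?_ fun s1 h1 =>
    Runs.seq hL (k := 2) (Q := I 0) ?_ fun s2 h1 => Runs.seq hL (Q := I n)
    (Runs.countUp (N := n) (k := 1) hL I (by decide) (by omega) ?_ ?_ h1 ?_)
    fun s3 h1 => Runs.store hL (i := .reg 3) (e := .combine (.arr 1 (.reg 3)) (.arr 1 (.reg 2)))
      (by decide) ?_ (by decide) ?_ ?_).mono (by omega)
      (fun _ h => h)
  · refine Runs.assign hL (by decide) ⟨h.small_index h3 h5 (by omega) (by omega), ?_⟩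
      ⟨AgreeOff.setReg (fun _ _ => rfl) (by decide) _, rfl, ?_⟩
    · rw [h.eval_index h3 h5, h.mat]; exact (hF _ _).trans hKL
    · simp [State.setReg, Expr.eval, h.eval_index h3 h5, h.mat]
  · obtain ⟨ha, harr, h8⟩ := h1
    have e2 := (ha 2 (by decide)).trans h2
    have e3 := (ha 3 (by decide)).trans h3
    have e6 := (ha 6 (by decide)).trans h6
    have hH : Holds F G s1 := h.congr (ha 0 (by decide)) (ha 1 (by decide)) (by rw [harr])
      (by rw [harr])
    have hsm : (Expr.sub (.reg 3) (.reg 2)).Small s1 L := by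
      simp [Expr.Small, e2, e3]; omega
    refine Runs.ite hL (by decide) ⟨hsm, hsm⟩ (fun hpos => ?_) (fun hneg => ?_)
    · have hir : i ≠ r := by
        rintro rfl
        simp [Expr.eval, e2, e3] at hpos
      exact Runs.skip hL ⟨ha, fun a _ => by rw [harr], by simp [hfdef, hir, h8], by simpa using hH⟩
    · have hir : i = r := by
        by_contra hne
        apply hneg
        simp only [Expr.eval, e2, e3]
        refine mul_self_pos.mpr (sub_ne_zero.mpr fun h0 => hne (Fin.ext ?_))
        exact_mod_cast h0
      refine Runs.assign hL (by decide) ?_ ⟨ha.setReg (by decide) _, fun a _ => by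
        simp [State.setReg, harr], ?_, ?_⟩
      · simp only [Expr.Small, h8, e6]
        exact ⟨(hF _ _).trans hKL, hdK.trans hKL⟩
      · simp [State.setReg, Expr.eval, h8, e6, hfdef, hir]
      · simpa using hH.setReg (by norm_num) _
  · intro k s' hs
    have := hs.2.2.2.cols
    simp [Expr.Small, Expr.eval, this]
    omega
  · rintro k s' v ⟨g1, g2, g3, g4⟩
    exact ⟨g1.setReg (by decide) v, g2, by simpa [State.setReg] using g3,
      g4.setReg (by norm_num) v⟩
  · rintro k hk s' ⟨ha, harr, h8, hH⟩ h4
    have e2 := (ha 2 (by decide)).trans h2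
    have e3 := (ha 3 (by decide)).trans h3
    have e6 := (ha 6 (by decide)).trans h6
    have e7 := (ha 7 (by decide)).trans h7
    have e4 : s'.reg 4 = ((⟨k, hk⟩ : Fin n) : ℕ) := h4
    have v3 : s'.arr 0 ((Expr.index 3 4).eval s') = F i ⟨k, hk⟩ := by
      rw [hH.eval_index e3 e4, hH.mat]; simp
    have v2 : s'.arr 0 ((Expr.index 2 4).eval s') = F r ⟨k, hk⟩ := by
      rw [hH.eval_index e2 e4, hH.mat]; simp
    refine Runs.store hL (by decide) (hH.small_index e3 e4 (by omega) (by omega)) (by decide) ?_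
      ⟨h4, ha, fun a ha => ?_, h8, ?_⟩
    · simp only [Expr.combine, Expr.Small, v3, v2, h8, e6, e7]
      exact ⟨⟨⟨(hF _ _).trans hKL, hH.small_index e3 e4 (by omega) (by omega), (hF _ _).trans hKL⟩,
        hfK, hH.small_index e2 e4 (by omega) (by omega), (hF _ _).trans hKL⟩, hdK.trans hKL⟩
    · have : a ≠ 0 := by omega
      simpa [State.setArr, this] using harr a ha
    · have hv : (Expr.combine (.arr 0 (.index 3 4)) (.arr 0 (.index 2 4))).eval s' =
          f' ⟨k, hk⟩ := by
        simp only [Expr.combine, Expr.eval, v3, v2, h8, e6, e7]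
        -- The numerator is `d * f'`, so the integer quotient is exact.
        rw [← hf', Int.mul_ediv_cancel_left _ hd]
      rw [hv, hH.eval_index e3 e4]
      convert hH.setMat i ⟨k, hk⟩ (f' ⟨k, hk⟩) using 3 with i' j'
      by_cases hii : i' = i
      · by_cases hj : j' = ⟨k, hk⟩
        · subst hj; simp [hii]
        · have : (j' : ℕ) ≠ k := fun h => hj (Fin.ext h)
          have h2 : (j' : ℕ) < k + 1 ↔ (j' : ℕ) < k := by omega
          simp [hii, hj, h2]
      · simp [hii]
  · obtain ⟨ha, harr, h8, hH⟩ := h1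
    simp [Expr.Small, (ha 3 (by decide)).trans h3]
    omega
  · obtain ⟨ha, harr, h8, hH⟩ := h1
    simp only [Expr.combine, Expr.Small, Expr.eval, (ha 2 (by decide)).trans h2,
      (ha 3 (by decide)).trans h3, (ha 6 (by decide)).trans h6, (ha 7 (by decide)).trans h7, h8,
      hH.vec, Int.natAbs_natCast]
    exact ⟨⟨⟨(hF _ _).trans hKL, by omega, (hG _).trans hKL⟩, hfK, by omega, (hG _).trans hKL⟩,
      hdK.trans hKL⟩
  · obtain ⟨ha, harr, h8, hH⟩ := h1
    refine ⟨ha, fun a ha => ?_, ?_⟩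
    · have : a ≠ 1 := by omega
      simpa [State.setArr, this] using harr a ha
    · simp only [Expr.combine, Expr.eval, (ha 2 (by decide)).trans h2,
        (ha 3 (by decide)).trans h3, (ha 6 (by decide)).trans h6, (ha 7 (by decide)).trans h7, h8,
        hH.vec]
      rw [← hg', Int.mul_ediv_cancel_left _ hd]
      simpa using hH.setVec i g'

theorem Runs.pivot {K L : ℕ} (hK : K + 1 ≤ L) (hm : m ≤ 2 ^ K) (hn : n ≤ 2 ^ K)
    (h : Holds F G s) (hF : ∀ i j, (F i j).natAbs ≤ 2 ^ K) (hG : ∀ i, (G i).natAbs ≤ 2 ^ K)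
    {r : Fin m} {c : Fin n} {d : ℤ} (hd : d ≠ 0) (hdK : d.natAbs ≤ 2 ^ K)
    (h2 : s.reg 2 = (r : ℕ)) (h5 : s.reg 5 = (c : ℕ)) (h6 : s.reg 6 = d)
    {F' : Fin m → Fin n → ℤ} {G' : Fin m → ℤ}
    (hF' : ∀ i j, d * F' i j = F r c * F i j - (F i c - if i = r then d else 0) * F r j)
    (hG' : ∀ i, d * G' i = F r c * G i - (F i c - if i = r then d else 0) * G r)
    (hFK' : ∀ i j, (F' i j).natAbs ≤ 2 ^ K) (hGK' : ∀ i, (G' i).natAbs ≤ 2 ^ K) :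
    Runs L .pivot s (m * (n * 4 + 13) + 7) (fun s' => AgreeOff [3, 4, 6, 7, 8] s s' ∧
      (∀ a, 2 ≤ a → s'.arr a = s.arr a) ∧ s'.reg 6 = F r c ∧ Holds F' G' s') := by
  have hL : 1 ≤ L := by omega
  have hKL : 2 ^ K ≤ 2 ^ L := Nat.pow_le_pow_right (by norm_num) (by omega)
  -- The pivot row does not change, so the other rows read the same values whether they are updated
  -- before or after it.
  have hFr : ∀ j, F' r j = F r j := fun j => mul_left_cancel₀ hd (by rw [hF', if_pos rfl]; ring)
  have hGr : G' r = G r := mul_left_cancel₀ hd (by rw [hG', if_pos rfl]; ring)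
  let I : ℕ → State → Prop := fun k s' => AgreeOff [3, 4, 7, 8] s s' ∧
      (∀ a, 2 ≤ a → s'.arr a = s.arr a) ∧ s'.reg 7 = F r c ∧
      Holds (fun i j => if (i : ℕ) < k then F' i j else F i j)
        (fun i => if (i : ℕ) < k then G' i else G i) s'
  refine (Runs.seq hL (k := 1) (Q := I 0) ?_ fun s2 h1 => Runs.seq hL (k' := 1) (Q := I m)
    (Runs.countUp (N := m) (k := n * 4 + 10) hL I (by decide) (by omega) ?_ ?_ h1 ?_)
    fun s3 h1 => Runs.assign hL (by decide) ?_ ?_).mono (by ring_nf; omega) (fun _ h => h)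
  · refine Runs.assign hL (by decide) ⟨h.small_index h2 h5 (by omega) (by omega), ?_⟩
      ⟨AgreeOff.setReg (fun _ _ => rfl) (by decide) _, fun _ _ => rfl, ?_, ?_⟩
    · rw [h.eval_index h2 h5, h.mat]; exact (hF _ _).trans hKL
    · simp [State.setReg, Expr.eval, h.eval_index h2 h5, h.mat]
    · simpa using h.setReg (by norm_num) _
  · intro k s' hs
    have := hs.2.2.2.rows
    simp [Expr.Small, Expr.eval, this]
    omega
  · rintro k s' v ⟨g1, g2, g3, g4⟩
    exact ⟨g1.setReg (by decide) v, g2, by simpa [State.setReg] using g3,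
      g4.setReg (by norm_num) v⟩
  · rintro k hk s' ⟨ha, harr, h7, hH⟩ h3
    have hrow : ∀ j, (if (r : ℕ) < k then F' r j else F r j) = F r j := by
      intro j; rw [hFr]; simp
    have hvec : (if (r : ℕ) < k then G' r else G r) = G r := by rw [hGr]; simp
    refine (Runs.updateRow (i := ⟨k, hk⟩) (r := r) (c := c) (f' := F' ⟨k, hk⟩)
      (g' := G' ⟨k, hk⟩) hK hm hn hH ?_ ?_ hd hdK ((ha 2 (by decide)).trans h2) h3
      ((ha 5 (by decide)).trans h5) ((ha 6 (by decide)).trans h6) (by rw [h7, hrow]) ?_ ?_).mono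
      le_rfl ?_
    · intro i j; split_ifs
      exacts [hFK' _ _, hF _ _]
    · intro i; split_ifs
      exacts [hGK' _, hG _]
    · intro j
      simp only [hrow, hF', lt_irrefl, if_false]
    · simp only [hrow, hvec, hG', lt_irrefl, if_false]
    · rintro s'' ⟨ha', harr', hH'⟩
      refine ⟨(ha' 3 (by decide)).trans h3, fun y hy => ?_, fun a h => (harr' a h).trans (harr a h),
        (ha' 7 (by decide)).trans h7, ?_⟩
      · simp only [List.mem_cons, not_or] at hy
        exact (ha' y (by simp [hy])).trans (ha y (by simp [hy]))
      · have key : ∀ (α : Type) (x y : Fin m → α) (i : Fin m),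
            (if (i : ℕ) < k + 1 then x i else y i) =
              if i = ⟨k, hk⟩ then x ⟨k, hk⟩ else if (i : ℕ) < k then x i else y i := by
          intro α x y i
          by_cases hi : i = ⟨k, hk⟩
          · subst hi; simp
          · have : (i : ℕ) ≠ k := fun h => hi (Fin.ext h)
            have h2 : (i : ℕ) < k + 1 ↔ (i : ℕ) < k := by omega
            simp [hi, h2]
        have e1 := funext₂ fun i j => key ℤ (fun i => F' i j) (fun i => F i j) i
        have e2 := funext fun i => key ℤ G' G i
        rw [← e1, ← e2] at hH'
        exact hH'
  · obtain ⟨ha, harr, h7, hH⟩ := h1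
    simp only [Expr.Small, h7]
    exact (hF _ _).trans hKL
  · obtain ⟨ha, harr, h7, hH⟩ := h1
    refine ⟨AgreeOff.setReg (fun y hy => ?_) (by decide) _, harr, ?_, ?_⟩
    · simp only [List.mem_cons, not_or] at hy
      exact ha y (by simp [hy])
    · simp [State.setReg, Expr.eval, h7]
    · simpa using hH.setReg (x := 6) (by norm_num) _

end BitRAM

/-! ### Runs of the whole elimination and of the read-off -/

namespace BitRAM

variable {m n : ℕ} {s s' : State}

/-- The state `s` represents a stage of the elimination. -/
def AtStage (A : Matrix (Fin m) (Fin n) ℤ) (b : Fin m → ℤ) (S r : ℕ) (s : State) : Prop :=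
  ∃ (E : Matrix (Fin m) (Fin m) ℤ) (B : Fin m → ℕ) (flag : ℤ), Stage A b S r E B flag ∧
    Holds (fun i j => E.cramer (fun k => A k j) i) (E.cramer b) s ∧
    s.reg 6 = E.det ∧ s.reg 9 = flag ∧ ∀ i : Fin m, (i : ℕ) < r → s.arr 3 (i : ℕ) = B i

theorem arr_three_update {r : Fin m} {B : Fin m → ℕ} {v : ℕ}
    (h : ∀ i : Fin m, (i : ℕ) < r → s.arr 3 (i : ℕ) = B i)
    (h' : s'.arr 3 = (s.setArr 3 (r : ℕ) v).arr 3) :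
    ∀ i : Fin m, (i : ℕ) < r + 1 → s'.arr 3 (i : ℕ) = Function.update B r v i := by
  intro i hi
  rw [h']
  by_cases hir : i = r
  · subst hir; simp [State.setArr]
  · have h1 : (i : ℕ) ≠ r := fun h => hir (Fin.ext h)
    have h2 := h i (by omega)
    simpa [State.setArr, hir, Function.update_apply, Fin.val_inj] using h2

theorem Runs.processRow {K L S : ℕ} (hK : K + 1 ≤ L) (hKS : m * (m + S) ≤ K)
    (hm : m ≤ 2 ^ K) (hn : n ≤ 2 ^ K)
    {A : Matrix (Fin m) (Fin n) ℤ} {b : Fin m → ℤ} (hA : ∀ i j, (A i j).natAbs ≤ 2 ^ S)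
    (hb : ∀ i, (b i).natAbs ≤ 2 ^ S) {r : Fin m} (h : AtStage A b S r s)
    (hr : s.reg 2 = (r : ℕ)) :
    Runs L .processRow s (m * (n * 4 + 13) + n * 5 + 16)
      (fun s' => s'.reg 2 = (r : ℕ) ∧ AtStage A b S (r + 1) s') := by
  obtain ⟨E, B, flag, hE, hH, h6, h9, h3⟩ := h
  have hL : 1 ≤ L := by omega
  have hKL : 2 ^ K ≤ 2 ^ L := Nat.pow_le_pow_right (by norm_num) (by omega)
  have hKK : 2 ^ (m * (m + S)) ≤ 2 ^ K := Nat.pow_le_pow_right (by norm_num) hKS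
  have hr' := r.2
  have hF : ∀ i j, (E.cramer (fun k => A k j) i).natAbs ≤ 2 ^ K := fun i j =>
    (Matrix.natAbs_cramer_le E hE.entry_le _ (fun k => hA k j) i).trans hKK
  have hG : ∀ i, (E.cramer b i).natAbs ≤ 2 ^ K := fun i =>
    (Matrix.natAbs_cramer_le E hE.entry_le _ hb i).trans hKK
  have hdK : E.det.natAbs ≤ 2 ^ K := (Matrix.natAbs_det_le E hE.entry_le).trans hKK
  refine (Runs.seq hL (Runs.search hK hm hn hH hF hr) (k' := m * (n * 4 + 13) + 10)
    fun s1 h1 => ?_).mono (by omega) (fun _ h => h)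
  obtain ⟨ha, harr, h5⟩ := h1
  have e2 := (ha 2 (by decide)).trans hr
  have e6 := (ha 6 (by decide)).trans h6
  have e9 := (ha 9 (by decide)).trans h9
  have hH1 := hH.congr (ha 0 (by decide)) (ha 1 (by decide)) (by rw [harr]) (by rw [harr])
  obtain ⟨c, hc, hcn⟩ : ∃ c : ℕ, s1.reg 5 = c ∧ c ≤ n := by
    rcases h5 with ⟨h5, -⟩ | ⟨c, h5, -⟩
    · exact ⟨n, h5, le_rfl⟩
    · exact ⟨c, h5, c.2.le⟩
  refine (Runs.seq hL (k := 1) (k' := m * (n * 4 + 13) + 8)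
    (Q := fun s2 => s2 = s1.setArr 3 (r : ℕ) c) (Runs.store hL (by decide) ?_ (by decide) ?_ ?_)
    fun s2 h2 => ?_).mono (by omega) (fun _ h => h)
  · simp [Expr.Small, e2]; omega
  · simp [Expr.Small, hc]; omega
  · simp [Expr.eval, e2, hc]
  subst h2
  have h3' := arr_three_update (s := s1) (s' := s1.setArr 3 (r : ℕ) c) (v := c)
    (by rw [harr]; exact h3) rfl
  have hH2 := hH1.setArr (a := 3) (by norm_num) (r : ℕ) c
  set s2 := s1.setArr 3 (r : ℕ) c with hs2
  have f2 : s2.reg 2 = (r : ℕ) := e2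
  have f5 : s2.reg 5 = c := hc
  refine Runs.ite hL (by decide) ?_ (fun hpos => ?_) (fun hneg => ?_)
  · simp [Expr.Small, hH2.cols, f5]; omega
  · simp only [Expr.eval, hH2.cols, f5] at hpos
    rcases h5 with ⟨h5, -⟩ | ⟨c', h5, hc'⟩
    · omega
    obtain rfl : c = c' := by rw [hc] at h5; exact_mod_cast h5
    have hstep := hE.pivot hA hc'
    refine (Runs.pivot hK hm hn hH2 hF hG hE.det_ne hdK f2 f5 e6
      (F' := fun i j => (E.updateCol r fun k => A k c').cramer (fun k => A k j) i)
      (G' := (E.updateCol r fun k => A k c').cramer b)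
      (fun i j => Matrix.cramer_updateCol_mul_det E r _ _ hc' i)
      (fun i => Matrix.cramer_updateCol_mul_det E r _ _ hc' i)
      (fun i j => (Matrix.natAbs_cramer_le _ hstep.entry_le _ (fun k => hA k j) i).trans hKK)
      (fun i => (Matrix.natAbs_cramer_le _ hstep.entry_le _ hb i).trans hKK)).mono le_rfl ?_
    rintro s3 ⟨g1, g2, g3, g4⟩
    refine ⟨(g1 2 (by decide)).trans f2, _, _, _, hstep, g4, ?_, (g1 9 (by decide)).trans e9, ?_⟩
    · rw [g3, Matrix.cramer_apply]
    · intro i hi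
      rw [g2 3 (by decide)]
      exact h3' i hi
  · simp only [Expr.eval, hH2.cols, f5] at hneg
    obtain rfl : c = n := by omega
    have h0 : ∀ j, E.cramer (fun k => A k j) r = 0 := by
      rcases h5 with ⟨-, h5⟩ | ⟨c', h5, -⟩
      · exact h5
      · have := c'.2
        rw [hc] at h5
        omega
    have hsm : (Expr.arr 1 (.reg 2)).Small s2 L := by
      simp only [Expr.Small, Expr.eval, f2, hH2.vec, Int.natAbs_natCast]
      exact ⟨by omega, (hG r).trans hKL⟩
    refine (Runs.ite (k := 1) (e := .mul (.arr 1 (.reg 2)) (.arr 1 (.reg 2))) hL (by decide)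
      ⟨hsm, hsm⟩ (fun hpos => ?_) (fun hneg => ?_)).mono
      (by omega) (fun _ h => h)
    · simp only [Expr.eval, f2, hH2.vec] at hpos
      have hne : E.cramer b r ≠ 0 := fun h => by simp [h] at hpos
      exact Runs.assign (e := .const 1) hL (by decide) trivial
        ⟨f2, _, _, _, hE.pass h0 (Or.inr ⟨hne, rfl⟩),
        hH2.setReg (by norm_num) _, e6, by simp [State.setReg, Expr.eval], h3'⟩
    · simp only [Expr.eval, f2, hH2.vec] at hneg
      have hz : E.cramer b r = 0 := by
        by_contra hne
        exact hneg (mul_self_pos.mpr hne)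
      exact Runs.skip hL ⟨f2, _, _, _, hE.pass h0 (Or.inl ⟨hz, rfl⟩), hH2, e6, e9, h3'⟩

theorem Runs.eliminate {K L S : ℕ} (hK : K + 1 ≤ L) (hKS : m * (m + S) ≤ K)
    (hm : m ≤ 2 ^ K) (hn : n ≤ 2 ^ K)
    {A : Matrix (Fin m) (Fin n) ℤ} {b : Fin m → ℤ} (hA : ∀ i j, (A i j).natAbs ≤ 2 ^ S)
    (hb : ∀ i, (b i).natAbs ≤ 2 ^ S) (h : IsInput A b s) :
    Runs L .eliminate s (m * (m * (n * 4 + 13) + n * 5 + 19) + 7) (AtStage A b S m) := by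
  have hL : 1 ≤ L := by omega
  have hKL : 2 ^ K ≤ 2 ^ L := Nat.pow_le_pow_right (by norm_num) (by omega)
  have hH : Holds A b s := ⟨h.1, h.2.1, h.2.2.1, h.2.2.2⟩
  have hI : ∀ k s v, AtStage A b S k s → AtStage A b S k (s.setReg 2 v) := by
    rintro k s v ⟨E, B, flag, h1, h2, h3, h4, h5⟩
    exact ⟨E, B, flag, h1, h2.setReg le_rfl v, by simpa [State.setReg] using h3,
      by simpa [State.setReg] using h4, h5⟩
  refine (Runs.seq hL (k := 1) (Q := fun s' => s' = s.setReg 6 1)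
    (Runs.assign (e := .const 1) hL (by decide) trivial rfl) fun s1 h1 =>
    Runs.seq hL (k := 1) (Q := fun s' => s' = s1.setReg 9 0)
    (Runs.assign (e := .const 0) hL (by decide) trivial rfl) fun s2 h2 =>
    Runs.countUp hL (N := m) (k := m * (n * 4 + 13) + n * 5 + 16) (AtStage A b S) (by decide)
      (by omega) ?_ hI ?_ ?_).mono (by linarith) (fun _ h => h)
  · rintro k s' ⟨E, B, flag, -, h2, -⟩
    simp [Expr.Small, Expr.eval, h2.rows]
    omega
  -- For `E = 1` the adjugate is the identity, so the input arrays already represent the initial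
  -- stage.
  · subst h1 h2
    refine ⟨1, fun _ => 0, 0, Stage.zero A b S _, ?_, ?_, ?_, fun i hi => by omega⟩
    · simpa using (hH.setReg (x := 6) (by norm_num) 1).setReg (x := 9) (by norm_num) 0
    · simp [State.setReg]
    · simp [State.setReg]
  · intro k hk s' hs hx
    exact Runs.processRow (r := ⟨k, hk⟩) hK hKS hm hn hA hb hs hx

/-- Passed rows have `B i = n`, so their entries go to the spare cell `n` of array 2; this is why `n
+ 1` cells are cleared and tracked. Up to `m` numbers may meet in one cell, which costs at most `m`
further bits. -/
theorem Runs.readOff {K L : ℕ} (hK : K + m + 1 ≤ L) (hm : m ≤ 2 ^ K) (hn : n ≤ 2 ^ K)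
    {F : Fin m → Fin n → ℤ} {G : Fin m → ℤ} {B : Fin m → ℕ} (h : Holds F G s)
    (hG : ∀ i, (G i).natAbs ≤ 2 ^ K) (hB : ∀ i, B i ≤ n)
    (h3 : ∀ i : Fin m, s.arr 3 (i : ℕ) = B i) {flag d : ℤ} (hd : d.natAbs ≤ 2 ^ K)
    (h6 : s.reg 6 = d) (h9 : s.reg 9 = flag) (hflag : flag.natAbs ≤ 1) :
    Runs L .readOff s (m * 4 + n * 4 + 20) (fun s' => s'.reg 0 = 1 - flag ∧ s'.reg 1 = d ∧
      ∀ j : Fin n, s'.arr 2 (j : ℕ) = ∑ i, if B i = j then G i else 0) := by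
  have hL : 1 ≤ L := by omega
  have hKL : 2 ^ (K + m + 1) ≤ 2 ^ L := Nat.pow_le_pow_right (by norm_num) hK
  have hK1 : 2 ^ K + 2 ^ K ≤ 2 ^ (K + m + 1) :=
    calc 2 ^ K + 2 ^ K = 2 ^ (K + 1) := by rw [pow_succ]; omega
      _ ≤ _ := Nat.pow_le_pow_right (by norm_num) (by omega)
  have hmK : m * 2 ^ K ≤ 2 ^ L :=
    calc m * 2 ^ K ≤ 2 ^ m * 2 ^ K := Nat.mul_le_mul_right _ Nat.lt_two_pow_self.le
      _ = 2 ^ (K + m) := by rw [← pow_add, add_comm]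
      _ ≤ 2 ^ L := Nat.pow_le_pow_right (by norm_num) (by omega)
  have h1K : 1 ≤ 2 ^ K := Nat.one_le_two_pow
  let I : ℕ → State → Prop := fun k s' => AgreeOff [4] s s' ∧
    (∀ a, a ≠ 2 → s'.arr a = s.arr a) ∧ ∀ j : ℕ, j < k → s'.arr 2 j = 0
  let J : ℕ → State → Prop := fun k s' => AgreeOff [2, 4] s s' ∧
    (∀ a, a ≠ 2 → s'.arr a = s.arr a) ∧
    ∀ j : ℕ, j ≤ n → s'.arr 2 j = ∑ i : Fin m, if (i : ℕ) < k ∧ B i = j then G i else 0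
  have hsum : ∀ (k j : ℕ), (∑ i : Fin m, if (i : ℕ) < k ∧ B i = j then G i else 0).natAbs ≤
      2 ^ L := by
    intro k j
    refine (Finset.sum_le_sum fun i _ => ?_ : _ ≤ ∑ _i : Fin m, 2 ^ K).trans
      (by simpa using hmK) |> (Int.natAbs_sum_le _ _).trans
    split_ifs
    · exact hG i
    · simp
  refine (Runs.seq hL (Q := I (n + 1)) (Runs.countUp (N := n + 1) (k := 1) hL I (by decide)
      (by omega) ?_ ?_ ⟨fun _ _ => rfl, fun _ _ => rfl, fun j hj => by omega⟩ ?_) fun s1 h1 =>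
    Runs.seq hL (Q := J m) (Runs.countUp (N := m) (k := 1) hL J (by decide) (by omega)
      ?_ ?_ ?_ ?_) fun s2 h2 =>
    Runs.seq hL (k := 1) (Q := fun s' => s' = s2.setReg 1 d) (Runs.assign hL (by decide) ?_ ?_)
      fun s3 h3 => Runs.assign hL (by decide) ?_ ?_).mono (by omega) (fun _ h => h)
  · rintro k s' ⟨ha, -⟩
    have := (ha 1 (by decide)).trans h.cols
    simp [Expr.Small, Expr.eval, this]
    omega
  · rintro k s' v ⟨g1, g2, g3⟩
    exact ⟨g1.setReg (by decide) v, g2, g3⟩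
  · rintro k hk s' ⟨g1, g2, g3⟩ h4
    refine Runs.store hL (by decide) ?_ (by decide) trivial ⟨h4, g1, fun a ha => ?_, fun j hj => ?_⟩
    · simp [Expr.Small, h4]; omega
    · simpa [State.setArr, ha] using g2 a ha
    · simp only [State.setArr, Function.update_self, Expr.eval, h4, Function.update_apply,
        Nat.cast_inj]
      split_ifs with hjk
      · rfl
      · exact g3 j (by omega)
  · rintro k s' ⟨ha, -⟩
    have := (ha 0 (by decide)).trans h.rows
    simp [Expr.Small, Expr.eval, this]
    omega
  · rintro k s' v ⟨g1, g2, g3⟩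
    exact ⟨g1.setReg (by decide) v, g2, g3⟩
  · obtain ⟨g1, g2, g3⟩ := h1
    refine ⟨fun y hy => ?_, g2, fun j hj => ?_⟩
    · simp only [List.mem_cons, not_or] at hy
      exact g1 y (by simp [hy])
    · rw [g3 j (by omega)]; simp
  · rintro k hk s' ⟨g1, g2, g3⟩ h2
    have e3 : s'.arr 3 (k : ℤ) = B ⟨k, hk⟩ := by rw [g2 3 (by decide)]; exact h3 ⟨k, hk⟩
    have e1 : s'.arr 1 (k : ℤ) = G ⟨k, hk⟩ := by rw [g2 1 (by decide)]; exact h.vec ⟨k, hk⟩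
    have hBk := hB ⟨k, hk⟩
    have e2 := g3 _ hBk
    have hsm : (Expr.arr 3 (.reg 2)).Small s' L := by
      simp only [Expr.Small, Expr.eval, h2, e3, Int.natAbs_natCast]
      omega
    refine Runs.store hL (by decide) hsm (by decide) ?_ ⟨h2, g1, fun a ha => ?_, fun j hj => ?_⟩
    · have := hG ⟨k, hk⟩
      refine ⟨⟨hsm, ?_⟩, ?_⟩
      · simp only [Expr.eval, h2, e3, e2]; exact hsum _ _
      · simp only [Expr.Small, Expr.eval, h2, e1, Int.natAbs_natCast]; omega
    · simpa [State.setArr, ha] using g2 a ha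
    · have hstep : (∑ i : Fin m, if (i : ℕ) < k + 1 ∧ B i = j then G i else 0) =
          (∑ i : Fin m, if (i : ℕ) < k ∧ B i = j then G i else 0) +
            if B ⟨k, hk⟩ = j then G ⟨k, hk⟩ else 0 := by
        have : ∀ i : Fin m, (if (i : ℕ) < k + 1 ∧ B i = j then G i else 0) =
            (if (i : ℕ) < k ∧ B i = j then G i else 0) +
              if i = ⟨k, hk⟩ then (if B ⟨k, hk⟩ = j then G ⟨k, hk⟩ else 0) else 0 := by
          intro i
          by_cases hi : i = ⟨k, hk⟩
          · subst hi; simp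
          · have h1 : (i : ℕ) ≠ k := fun h => hi (Fin.ext h)
            have h2 : (i : ℕ) < k + 1 ↔ (i : ℕ) < k := by omega
            simp [hi, h2]
        rw [Finset.sum_congr rfl fun i _ => this i, Finset.sum_add_distrib]
        simp
      simp only [State.setArr, Function.update_self, Expr.eval, h2, e3, e1, e2,
        Function.update_apply, Nat.cast_inj]
      rw [hstep]
      by_cases hjB : j = B ⟨k, hk⟩
      · simp [hjB]
      · rw [if_neg hjB, if_neg (Ne.symm hjB), add_zero, g3 j hj]
  · obtain ⟨g1, -⟩ := h2
    simp only [Expr.Small, (g1 6 (by decide)).trans h6]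
    omega
  · obtain ⟨g1, -⟩ := h2
    simp [Expr.eval, (g1 6 (by decide)).trans h6]
  · obtain ⟨g1, -⟩ := h2
    have e9 : s3.reg 9 = flag := by rw [h3]; exact (g1 9 (by decide)).trans h9
    simp only [Expr.Small, e9, true_and]
    omega
  · obtain ⟨g1, g2, g3⟩ := h2
    have e9 : s3.reg 9 = flag := by rw [h3]; exact (g1 9 (by decide)).trans h9
    refine ⟨by simp [State.setReg, Expr.eval, e9], by simp [State.setReg, h3], fun j => ?_⟩
    have := g3 j j.2.le
    simp only [Fin.is_lt, true_and] at this
    simpa [State.setReg, h3] using this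

/-- Here `K = 2 * S ^ 2` dominates the determinant exponent `m * (m + S)`, and `S + 1` more bits
cover the needs of the read-off. -/
theorem Runs.solve {S : ℕ} (hm : 0 < m) (hmS : m ≤ S) (hnS : n ≤ S)
    {A : Matrix (Fin m) (Fin n) ℤ} {b : Fin m → ℤ} (hA : ∀ i j, (A i j).natAbs ≤ 2 ^ S)
    (hb : ∀ i, (b i).natAbs ≤ 2 ^ S) (h : IsInput A b s) :
    Runs (2 * S ^ 2 + S + 1) (.seq .eliminate .readOff) s
      (S * (S * (S * 4 + 13) + S * 5 + 19) + S * 8 + 28)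
      (fun s' => ∃ out : Option (ℤ × (Fin n → ℤ)), IsOutput out s' ∧ IsCorrectAnswer A b out) := by
  have hmS2 : m * (m + S) ≤ 2 * S ^ 2 := by nlinarith
  have hSK : S ≤ 2 ^ (2 * S ^ 2) :=
    Nat.lt_two_pow_self.le.trans (Nat.pow_le_pow_right (by norm_num) (by nlinarith))
  have hcnt : m * (m * (n * 4 + 13) + n * 5 + 19) ≤ S * (S * (S * 4 + 13) + S * 5 + 19) := by
    gcongr
  refine (Runs.seq (by omega) (Runs.eliminate (K := 2 * S ^ 2) (by omega) hmS2 (by omega) (by omega)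
    hA hb h) (k' := m * 4 + n * 4 + 20) fun s1 h1 => ?_).mono (by omega) (fun _ h => h)
  obtain ⟨E, B, flag, hE, hH, h6, h9, h3⟩ := h1
  have hKK : 2 ^ (m * (m + S)) ≤ 2 ^ (2 * S ^ 2) := Nat.pow_le_pow_right (by norm_num) hmS2
  refine (Runs.readOff (K := 2 * S ^ 2) (by omega) (by omega) (by omega) hH
    (fun i => (Matrix.natAbs_cramer_le E hE.entry_le _ hb i).trans hKK) (fun i => ?_)
    (fun i => h3 i i.2) ((Matrix.natAbs_det_le E hE.entry_le).trans hKK) h6 h9 ?_).mono le_rfl ?_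
  · rcases hE.row i i.2 with ⟨j, hj, -⟩ | ⟨hj, -⟩
    · exact hj ▸ j.2.le
    · exact hj.le
  · rcases hE.flag_eq with h | ⟨h, -⟩ <;> simp [h]
  · rintro s2 ⟨g0, g1, g2⟩
    rcases hE.flag_eq with rfl | ⟨rfl, hno⟩
    · exact ⟨some (E.det, fun j => ∑ i, if B i = j then E.cramer b i else 0),
        ⟨by simpa using g0, g1, g2⟩, hE.det_ne, hE.isRealSolution fun _ => rfl⟩
    · exact ⟨none, by simpa [IsOutput] using g0, hno⟩

end BitRAM

/-! ### Input size and the main theorem -/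

theorem bitSize_le_matBitSize {m n : ℕ} (A : Matrix (Fin m) (Fin n) ℤ) (i : Fin m) (j : Fin n) :
    bitSize (A i j) ≤ matBitSize A :=
  (Finset.single_le_sum (f := fun j => bitSize (A i j)) (fun _ _ => Nat.zero_le _)
    (Finset.mem_univ j)).trans
    (Finset.single_le_sum (f := fun i => ∑ j, bitSize (A i j)) (fun _ _ => Nat.zero_le _)
      (Finset.mem_univ i))

theorem bitSize_le_vecBitSize {m : ℕ} (b : Fin m → ℤ) (i : Fin m) :
    bitSize (b i) ≤ vecBitSize b :=
  Finset.single_le_sum (f := fun i => bitSize (b i)) (fun _ _ => Nat.zero_le _)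
    (Finset.mem_univ i)

theorem card_le_vecBitSize {m : ℕ} (b : Fin m → ℤ) : m ≤ vecBitSize b := by
  have := Finset.sum_le_sum (s := Finset.univ) fun (i : Fin m) _ => one_le_bitSize (b i)
  simpa [vecBitSize] using this

/-- One row already has `n` entries of bit size at least `1`. With no rows the input would have size
`0` while `n` is arbitrary. -/
theorem card_le_matBitSize {m n : ℕ} (hm : 0 < m) (A : Matrix (Fin m) (Fin n) ℤ) :
    n ≤ matBitSize A :=
  (card_le_vecBitSize (A ⟨0, hm⟩)).trans
    (Finset.single_le_sum (f := fun i => ∑ j, bitSize (A i j)) (fun _ _ => Nat.zero_le _)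
      (Finset.mem_univ _))

theorem mainTheorem10 :
    ∃ (P : BitRAM.Prog) (p : Polynomial ℕ),
      ∀ (m n : ℕ), 0 < m → ∀ (A : Matrix (Fin m) (Fin n) ℤ) (b : Fin m → ℤ) (s : BitRAM.State),
        BitRAM.IsInput A b s →
          ∃ (t : ℕ) (s' : BitRAM.State) (out : Option (ℤ × (Fin n → ℤ))),
            BitRAM.Exec P s t s' ∧
            t ≤ p.eval (matBitSize A + vecBitSize b) ∧
            BitRAM.IsOutput out s' ∧
            IsCorrectAnswer A b out := by
  let X : Polynomial ℕ := Polynomial.X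
  refine ⟨.seq .eliminate .readOff,
    -- The number of cost units from `Runs.solve` times the unit `3000 * L ^ 2` for `L = 2 * X ^ 2 +
    -- X + 1`, where `X` stands for the input size, which bounds `m`, `n` and all bit sizes of the
    -- data.
    (X * (X * (X * 4 + 13) + X * 5 + 19) + X * 8 + 28) * (3000 * (2 * X ^ 2 + X + 1) ^ 2), ?_⟩
  intro m n hm A b s hs
  have hbit : ∀ a : ℤ, bitSize a ≤ matBitSize A + vecBitSize b →
      a.natAbs ≤ 2 ^ (matBitSize A + vecBitSize b) := fun a ha =>
    (natAbs_le_two_pow_bitSize a).trans (Nat.pow_le_pow_right (by norm_num) ha)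
  obtain ⟨t, s', hex, ht, out, ho, hc⟩ := BitRAM.Runs.solve hm
    ((card_le_vecBitSize b).trans (Nat.le_add_left _ _))
    ((card_le_matBitSize hm A).trans (Nat.le_add_right _ _))
    (fun i j => hbit _ ((bitSize_le_matBitSize A i j).trans (Nat.le_add_right _ _)))
    (fun i => hbit _ ((bitSize_le_vecBitSize b i).trans (Nat.le_add_left _ _))) hs
  refine ⟨t, s', out, hex, ht.trans (le_of_eq ?_), ho, hc⟩
  simp [X]
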